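/- Let $\mathbb{D}=\{z\in\mathbb{C}:|z|<1\}$ and let $\mu:[0,1)\to[0,\infty)$ be a radial weight, that is, $\mu$ is integrable on $[0,1)$ and $\widehat{\mu}(z):=\int_{|z|}^1\mu(s)\,ds>0$ for all $z\in\mathbb{D}$. For an analytic function $f(z)=\sum_{n=0}^\infty \widehat{f}(n)z^n$ in $\mathbb{D}$ put $$D^\mu(f)(z)=\sum_{n=0}^\infty\frac{\widehat{f}(n)}{\mu_{2n+1}}z^n,\quad z\in\mathbb{D},\qquad \mu_{2n+1}=\int_0^1 r^{2n+1}\mu(r)\,dr,$$ a series which converges in $\mathbb{D}$. Let $\mathcal{B}^\mu$ be the space of all analytic functions $f$ in $\mathbb{D}$ with $\sup_{z\in\mathbb{D}}\widehat{\mu}(z)|D^\mu(f)(z)|<\infty$, and let $H^\infty$ be the space of all bounded analytic functions in $\mathbb{D}$. Then $H^\infty\neq\mathcal{B}^\mu$ (as sets of functions). -/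

import Mathlib

open MeasureTheory

noncomputable section

/-- `μ` (the radial profile, of which only the values on `[0,1)` matter) is a radial weight: it is
nonnegative and integrable on `[0,1)`, and its integral over each `[r,1)`, `0 ≤ r < 1`, is
positive. -/
structure IsRadialWeight (μ : ℝ → ℝ) : Prop where
  nonneg : ∀ r ∈ Set.Ico (0 : ℝ) 1, 0 ≤ μ r
  integrableOn : IntegrableOn μ (Set.Ico (0 : ℝ) 1)
  tail_pos : ∀ r ∈ Set.Ico (0 : ℝ) 1, 0 < ∫ s in Set.Ico r 1, μ s

/-- The function `μ̂(z) = ∫_{|z|}^1 μ(s) ds`. -/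
def weightTail (μ : ℝ → ℝ) (z : ℂ) : ℝ :=
  ∫ s in Set.Ico ‖z‖ 1, μ s

/-- The moment `μ_k = ∫_0^1 r^k μ(r) dr`. -/
def weightMoment (μ : ℝ → ℝ) (k : ℕ) : ℝ :=
  ∫ r in Set.Ico (0 : ℝ) 1, r ^ k * μ r

/-- The `n`-th Taylor coefficient of `f` at the origin. -/
def taylorCoeff (f : ℂ → ℂ) (n : ℕ) : ℂ :=
  iteratedDeriv n f 0 / (n.factorial : ℂ)

/-- The fractional derivative `D^μ(f)(z) = ∑ f̂(n) / μ_{2n+1} z^n`. -/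
def fracDeriv (μ : ℝ → ℝ) (f : ℂ → ℂ) (z : ℂ) : ℂ :=
  ∑' n : ℕ, taylorCoeff f n / (weightMoment μ (2 * n + 1) : ℂ) * z ^ n

/-- `H^∞`: the bounded analytic functions in the unit disc (values outside the disc are
irrelevant). -/
def hardyInfty : Set (ℂ → ℂ) :=
  {f | AnalyticOnNhd ℂ f (Metric.ball 0 1) ∧
    BddAbove ((fun z => ‖f z‖) '' Metric.ball 0 1)}

/-- `𝓑^μ`: the analytic functions `f` in the unit disc with
`sup_{|z| < 1} μ̂(z) |D^μ(f)(z)| < ∞` (values outside the disc are irrelevant). -/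
def blochMu (μ : ℝ → ℝ) : Set (ℂ → ℂ) :=
  {f | AnalyticOnNhd ℂ f (Metric.ball 0 1) ∧
    BddAbove ((fun z => weightTail μ z * ‖fracDeriv μ f z‖) '' Metric.ball 0 1)}

/-- A lower bound for the moments; in particular they are positive. -/
theorem IsRadialWeight.le_weightMoment {μ : ℝ → ℝ} (hμ : IsRadialWeight μ) {s : ℝ}
    (hs : s ∈ Set.Ico (0 : ℝ) 1) (k : ℕ) :
    s ^ k * ∫ r in Set.Ico s 1, μ r ≤ weightMoment μ k := by
  have hsub : Set.Ico s 1 ⊆ Set.Ico (0 : ℝ) 1 := Set.Ico_subset_Ico_left hs.1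
  have hint : IntegrableOn (fun r => r ^ k * μ r) (Set.Ico (0 : ℝ) 1) := by
    refine Integrable.mono hμ.integrableOn
      ((by fun_prop : AEStronglyMeasurable (fun r : ℝ => r ^ k) _).mul
        hμ.integrableOn.aestronglyMeasurable) ?_
    refine (ae_restrict_iff' measurableSet_Ico).2 (Filter.Eventually.of_forall fun r hr => ?_)
    rw [norm_mul, norm_pow]
    refine mul_le_of_le_one_left (norm_nonneg _) (pow_le_one₀ (norm_nonneg _) ?_)
    rw [Real.norm_eq_abs, abs_of_nonneg hr.1]
    exact hr.2.le
  rw [← integral_const_mul]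
  calc ∫ r in Set.Ico s 1, s ^ k * μ r ≤ ∫ r in Set.Ico s 1, r ^ k * μ r :=
        setIntegral_mono_on ((hμ.integrableOn.mono_set hsub).const_mul _) (hint.mono_set hsub)
          measurableSet_Ico fun r hr =>
            mul_le_mul_of_nonneg_right (pow_le_pow_left₀ hs.1 hr.1 k) (hμ.nonneg r (hsub hr))
    _ ≤ weightMoment μ k := by
        refine setIntegral_mono_set hint ?_ (Filter.Eventually.of_forall hsub)
        exact (ae_restrict_iff' measurableSet_Ico).2 (Filter.Eventually.of_forall fun r hr =>
          mul_nonneg (pow_nonneg hr.1 k) (hμ.nonneg r hr))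

/-- The series that defines `D^μ(f)` converges in the whole disc for every analytic `f`. -/
theorem IsRadialWeight.summable_fracDeriv {μ : ℝ → ℝ} (hμ : IsRadialWeight μ) {f : ℂ → ℂ}
    (hf : AnalyticOnNhd ℂ f (Metric.ball 0 1)) {z : ℂ} (hz : z ∈ Metric.ball (0 : ℂ) 1) :
    Summable fun n : ℕ => taylorCoeff f n / (weightMoment μ (2 * n + 1) : ℂ) * z ^ n := by
  have hz1 : ‖z‖ < 1 := by simpa using hz
  have hz0 := norm_nonneg z
  set s : ℝ := Real.sqrt ((1 + ‖z‖) / 2) with hs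
  have hs2 : s ^ 2 = (1 + ‖z‖) / 2 := Real.sq_sqrt (by positivity)
  have hs0 : 0 < s := Real.sqrt_pos.2 (by positivity)
  have hs1 : s < 1 := by nlinarith
  have hT := hμ.tail_pos s ⟨hs0.le, hs1⟩
  set T := ∫ r in Set.Ico s 1, μ r
  have hw : ((‖z‖ / s ^ 2 : ℝ) : ℂ) ∈ Metric.ball (0 : ℂ) 1 := by
    rw [mem_ball_zero_iff, Complex.norm_real, Real.norm_eq_abs, abs_of_nonneg (by positivity),
      div_lt_one (by positivity), hs2]
    linarith
  have hsum := (Complex.hasSum_taylorSeries_on_ball hf.differentiableOn hw).summable.norm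
  refine Summable.of_norm_bounded (hsum.mul_left (s * T)⁻¹) fun n => ?_
  have hm := hμ.le_weightMoment ⟨hs0.le, hs1⟩ (2 * n + 1)
  have hpos : 0 < s ^ (2 * n + 1) * T := by positivity
  have hm0 := hpos.trans_le hm
  simp only [taylorCoeff, norm_mul, norm_div, norm_smul, norm_pow, norm_inv, sub_zero,
    Complex.norm_real, Complex.norm_natCast, Real.norm_eq_abs, abs_of_pos hm0, abs_norm,
    abs_of_pos hs0, smul_eq_mul]
  calc ‖iteratedDeriv n f 0‖ / n.factorial / weightMoment μ (2 * n + 1) * ‖z‖ ^ n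
      ≤ ‖iteratedDeriv n f 0‖ / n.factorial / (s ^ (2 * n + 1) * T) * ‖z‖ ^ n := by gcongr
    _ = _ := by
        rw [pow_succ, pow_mul, div_pow]
        field_simp

end

open Filter Topology

/-! Everything depends on the sizes of the monomials `z ^ n` in the seminorm of `𝓑^μ`, that is, on
the suprema over `r` of `monomialSize μ n r`; in `H^∞` each monomial has norm `1`.

If these suprema stay bounded for large `n`, exponents can be chosen so sparse that the humps of the
monomials barely overlap (`exists_strictMono_monomialSize_le`). Then `∑ z ^ φ k` lies in `𝓑^μ`,
while it is unbounded as `z → 1` along the radius.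

If not, choose `φ` so that the `k`-th monomial somewhere exceeds `4 ^ k`. Then `∑ 2⁻ᵏ z ^ φ k` is
bounded by `2`, but its seminorm in `𝓑^μ` is at least `2 ^ k` for every `k`: on the positive radius
all terms are nonnegative, so nothing cancels. -/

/-- A power series with coefficients bounded by `1` represents its sum on the unit disc. -/
theorem hasFPowerSeriesOnBall_tsum_of_norm_le_one {c : ℕ → ℂ} (hc : ∀ n, ‖c n‖ ≤ 1) :
    HasFPowerSeriesOnBall (fun z => ∑' n, c n * z ^ n)
      (FormalMultilinearSeries.ofScalars ℂ c) 0 1 := by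
  have hr : 1 ≤ (FormalMultilinearSeries.ofScalars ℂ c).radius := by
    refine mod_cast FormalMultilinearSeries.le_radius_of_bound _ 1 (r := 1) fun n => ?_
    rw [FormalMultilinearSeries.ofScalars_norm]
    simpa using hc n
  have h := (FormalMultilinearSeries.hasFPowerSeriesOnBall
    (FormalMultilinearSeries.ofScalars ℂ c) (one_pos.trans_le hr)).mono one_pos hr
  have hsum : (FormalMultilinearSeries.ofScalars ℂ c).sum = fun z => ∑' n, c n * z ^ n := by
    funext z
    exact FormalMultilinearSeries.ofScalars_sum_eq c z
  rwa [hsum] at h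

theorem taylorCoeff_tsum_of_norm_le_one {c : ℕ → ℂ} (hc : ∀ n, ‖c n‖ ≤ 1) (n : ℕ) :
    taylorCoeff (fun z => ∑' n, c n * z ^ n) n = c n := by
  have h := (hasFPowerSeriesOnBall_tsum_of_norm_le_one hc).hasFPowerSeriesAt
  have h2 := h.analyticAt.hasFPowerSeriesAt.eq_formalMultilinearSeries h
  have h3 := congrArg (fun p => FormalMultilinearSeries.coeff p n) h2
  simpa only [FormalMultilinearSeries.coeff_ofScalars, taylorCoeff] using h3

/-! ### Gap series and their fractional derivatives -/

/-- The power series with the coefficient `b k` at the exponent `φ k`. -/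
noncomputable def gapSeries (φ : ℕ → ℕ) (b : ℕ → ℝ) (z : ℂ) : ℂ :=
  ∑' k, (b k : ℂ) * z ^ φ k

section GapSeries

variable {φ : ℕ → ℕ} {b : ℕ → ℝ}

/-- Filling the gaps with zero coefficients turns a gap series into an ordinary power series, from
which Taylor coefficients can be read off. -/
theorem tsum_extend_mul (hφ : Function.Injective φ) (a : ℕ → ℂ) (u : ℕ → ℂ) :
    ∑' n, Function.extend φ a 0 n * u n = ∑' k, a k * u (φ k) := by
  rw [← hφ.tsum_eq (f := fun n => Function.extend φ a 0 n * u n)]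
  · simp only [hφ.extend_apply]
  · intro n hn
    by_contra h
    refine hn ?_
    simp only
    rw [Function.extend_apply' _ _ _ h]
    simp

theorem gapSeries_eq (hφ : Function.Injective φ) :
    gapSeries φ b = fun z => ∑' n, Function.extend φ (fun k => (b k : ℂ)) 0 n * z ^ n := by
  funext z
  exact (tsum_extend_mul hφ _ fun n => z ^ n).symm

theorem norm_extend_le_one (hφ : Function.Injective φ) (hb : ∀ k, |b k| ≤ 1) (n : ℕ) :
    ‖Function.extend φ (fun k => (b k : ℂ)) 0 n‖ ≤ 1 := by
  by_cases h : ∃ k, φ k = n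
  · obtain ⟨k, rfl⟩ := h
    rw [hφ.extend_apply]
    simpa using hb k
  · rw [Function.extend_apply' _ _ _ h]
    simp

theorem analyticOnNhd_gapSeries (hφ : Function.Injective φ) (hb : ∀ k, |b k| ≤ 1) :
    AnalyticOnNhd ℂ (gapSeries φ b) (Metric.ball 0 1) := by
  have h := (hasFPowerSeriesOnBall_tsum_of_norm_le_one
    (norm_extend_le_one hφ hb)).analyticOnNhd
  rw [← gapSeries_eq hφ] at h
  simpa [← Metric.eball_ofReal] using h

theorem taylorCoeff_gapSeries (hφ : Function.Injective φ) (hb : ∀ k, |b k| ≤ 1) (k : ℕ) :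
    taylorCoeff (gapSeries φ b) (φ k) = b k := by
  rw [gapSeries_eq hφ, taylorCoeff_tsum_of_norm_le_one (norm_extend_le_one hφ hb),
    hφ.extend_apply]

theorem fracDeriv_gapSeries (μ : ℝ → ℝ) (hφ : Function.Injective φ) (hb : ∀ k, |b k| ≤ 1)
    (z : ℂ) :
    fracDeriv μ (gapSeries φ b) z =
      ∑' k, (b k : ℂ) / (weightMoment μ (2 * φ k + 1) : ℂ) * z ^ φ k := by
  have h := tsum_extend_mul hφ (fun k => (b k : ℂ))
    fun n => z ^ n / (weightMoment μ (2 * n + 1) : ℂ)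
  simp only [fracDeriv, gapSeries_eq hφ,
    taylorCoeff_tsum_of_norm_le_one (norm_extend_le_one hφ hb)]
  simpa only [div_mul_eq_mul_div, mul_div_assoc] using h

theorem summable_norm_fracDeriv_gapSeries {μ : ℝ → ℝ} (hμ : IsRadialWeight μ)
    (hφ : Function.Injective φ) (hb : ∀ k, |b k| ≤ 1) {z : ℂ} (hz : z ∈ Metric.ball (0 : ℂ) 1) :
    Summable fun k => ‖(b k : ℂ) / (weightMoment μ (2 * φ k + 1) : ℂ) * z ^ φ k‖ := by
  have h := ((hμ.summable_fracDeriv (analyticOnNhd_gapSeries hφ hb) hz).comp_injective hφ).norm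
  refine h.congr fun k => ?_
  simp only [Function.comp_apply, taylorCoeff_gapSeries hφ hb]

end GapSeries

/-! ### Sizes of monomials and the gliding hump -/

/-- The size `μ̂(r) r ^ n / μ_{2n+1}` on the circle of radius `r` of the monomial `z ^ n`, as
measured by the seminorm of `𝓑^μ`. -/
noncomputable def monomialSize (μ : ℝ → ℝ) (n : ℕ) (r : ℝ) : ℝ :=
  (∫ s in Set.Ico r 1, μ s) * (r ^ n / weightMoment μ (2 * n + 1))

namespace IsRadialWeight

variable {μ : ℝ → ℝ}

theorem weightMoment_pos (hμ : IsRadialWeight μ) (k : ℕ) : 0 < weightMoment μ k := by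
  have h := hμ.le_weightMoment (s := 1 / 2) (by norm_num) k
  have := hμ.tail_pos (1 / 2) (by norm_num)
  exact lt_of_lt_of_le (by positivity) h

theorem monomialSize_nonneg (hμ : IsRadialWeight μ) (n : ℕ) {r : ℝ}
    (hr : r ∈ Set.Ico (0 : ℝ) 1) : 0 ≤ monomialSize μ n r :=
  mul_nonneg (hμ.tail_pos r hr).le
    (div_nonneg (pow_nonneg hr.1 n) (hμ.weightMoment_pos _).le)

theorem tail_antitoneOn (hμ : IsRadialWeight μ) :
    AntitoneOn (fun r => ∫ s in Set.Ico r 1, μ s) (Set.Ico (0 : ℝ) 1) := by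
  intro r hr t _ hrt
  have hsub := Set.Ico_subset_Ico_left (b := (1 : ℝ)) hr.1
  refine setIntegral_mono_set (hμ.integrableOn.mono_set hsub) ?_
    (Eventually.of_forall (Set.Ico_subset_Ico_left hrt))
  exact (ae_restrict_iff' measurableSet_Ico).2
    (Eventually.of_forall fun s hs => hμ.nonneg s (hsub hs))

/-- The intervals `[1 - 1/(n+1), 1)` decrease to the empty set, so the integrals of `μ` over them
tend to `0`. -/
theorem exists_tail_lt (hμ : IsRadialWeight μ) {ε : ℝ} (hε : 0 < ε) :
    ∃ r ∈ Set.Ico (0 : ℝ) 1, ∫ s in Set.Ico r 1, μ s < ε := by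
  have h := tendsto_setIntegral_of_antitone (μ := volume) (f := μ)
    (s := fun n : ℕ => Set.Ico (1 - 1 / ((n : ℝ) + 1)) 1) (fun _ => measurableSet_Ico)
    (fun m n hmn => Set.Ico_subset_Ico_left
      (sub_le_sub_left (Nat.one_div_le_one_div hmn) 1))
    ⟨0, by simpa using hμ.integrableOn⟩
  have hempty : ⋂ n : ℕ, Set.Ico (1 - 1 / ((n : ℝ) + 1)) 1 = ∅ := by
    refine Set.eq_empty_iff_forall_notMem.2 fun x hx => ?_
    rw [Set.mem_iInter] at hx
    obtain ⟨n, hn⟩ := exists_nat_one_div_lt (sub_pos.2 (hx 0).2)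
    linarith [(hx n).1]
  rw [hempty, setIntegral_empty] at h
  obtain ⟨n, hn⟩ := (h.eventually (gt_mem_nhds hε)).exists
  refine ⟨_, ⟨?_, ?_⟩, hn⟩
  · rw [sub_nonneg, div_le_one (by positivity)]
    linarith [n.cast_nonneg (α := ℝ)]
  · linarith [Nat.one_div_pos_of_nat (α := ℝ) (n := n)]

/-- Close to the boundary, each monomial is small. -/
theorem exists_monomialSize_le (hμ : IsRadialWeight μ) (n : ℕ) {ε : ℝ} (hε : 0 < ε) :
    ∃ ρ ∈ Set.Ico (0 : ℝ) 1, ∀ r ∈ Set.Ico ρ 1, monomialSize μ n r ≤ ε := by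
  have hm := hμ.weightMoment_pos (2 * n + 1)
  obtain ⟨ρ, hρ, h⟩ := hμ.exists_tail_lt (mul_pos hε hm)
  refine ⟨ρ, hρ, fun r hr => ?_⟩
  have hr' : r ∈ Set.Ico (0 : ℝ) 1 := ⟨hρ.1.trans hr.1, hr.2⟩
  calc monomialSize μ n r ≤ (ε * weightMoment μ (2 * n + 1)) *
        (1 / weightMoment μ (2 * n + 1)) := by
        refine mul_le_mul ((hμ.tail_antitoneOn hρ hr' hr.1).trans h.le) ?_
          (div_nonneg (pow_nonneg hr'.1 n) hm.le) (by positivity)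
        gcongr
        exact pow_le_one₀ hr'.1 hr'.2.le
    _ = ε := by field_simp

/-- Away from the boundary, monomials of high degree are small. -/
theorem eventually_monomialSize_le (hμ : IsRadialWeight μ) {ρ : ℝ}
    (hρ : ρ ∈ Set.Ico (0 : ℝ) 1) :
    ∀ᶠ n : ℕ in atTop, ∀ r ∈ Set.Icc 0 ρ, monomialSize μ n r ≤ 1 / ((n : ℝ) + 1) ^ 2 := by
  obtain ⟨hρ0, hρ1⟩ := hρ
  -- This puts `s ^ 2` strictly between `ρ` and `1`. The moment of order `2n+1` is at least a
  -- constant times `s ^ (2n)`, so the size decays like `(ρ / s ^ 2) ^ n`, which beats the factor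
  -- `(n + 1) ^ 2`.
  set s : ℝ := Real.sqrt ((1 + ρ) / 2) with hs
  have hs2 : s ^ 2 = (1 + ρ) / 2 := Real.sq_sqrt (by positivity)
  have hs0 : 0 < s := Real.sqrt_pos.2 (by positivity)
  have hs1 : s < 1 := by nlinarith
  have hT := hμ.tail_pos s ⟨hs0.le, hs1⟩
  have hT0 := hμ.tail_pos 0 (by norm_num)
  have hmom := fun n : ℕ => hμ.le_weightMoment ⟨hs0.le, hs1⟩ (2 * n + 1)
  set T := ∫ r in Set.Ico s 1, μ r
  set T₀ := ∫ r in Set.Ico 0 1, μ r with hT₀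
  have hq0 : 0 ≤ ρ / s ^ 2 := by positivity
  have hq1 : ρ / s ^ 2 < 1 := by
    rw [div_lt_one (by positivity), hs2]
    linarith
  have hq : |ρ / s ^ 2| < 1 := by rwa [abs_of_nonneg hq0]
  have hlim : Tendsto (fun n : ℕ => T₀ / (s * T) * (((n : ℝ) + 1) ^ 2 * (ρ / s ^ 2) ^ n))
      atTop (𝓝 0) := by
    have h2 := tendsto_pow_const_mul_const_pow_of_abs_lt_one 2 hq
    have h1 := tendsto_pow_const_mul_const_pow_of_abs_lt_one 1 hq
    have h0 := tendsto_pow_const_mul_const_pow_of_abs_lt_one 0 hq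
    have h := ((h2.add (h1.const_mul 2)).add h0).const_mul (T₀ / (s * T))
    simp only [mul_zero, add_zero] at h
    refine h.congr fun n => ?_
    ring
  filter_upwards [hlim.eventually (gt_mem_nhds one_pos)] with n hn r hr
  have hr' : r ∈ Set.Ico (0 : ℝ) 1 := ⟨hr.1, hr.2.trans_lt hρ1⟩
  have hpos : 0 < s ^ (2 * n + 1) * T := by positivity
  rw [le_div_iff₀ (by positivity)]
  calc monomialSize μ n r * ((n : ℝ) + 1) ^ 2
      ≤ (T₀ * (ρ ^ n / (s ^ (2 * n + 1) * T))) * ((n : ℝ) + 1) ^ 2 := by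
        refine mul_le_mul_of_nonneg_right ?_ (by positivity)
        refine mul_le_mul (hμ.tail_antitoneOn (by norm_num) hr' hr.1) ?_
          (div_nonneg (pow_nonneg hr.1 n) (hμ.weightMoment_pos _).le) hT0.le
        exact div_le_div₀ (by positivity) (pow_le_pow_left₀ hr.1 hr.2 n) hpos (hmom n)
    _ = T₀ / (s * T) * (((n : ℝ) + 1) ^ 2 * (ρ / s ^ 2) ^ n) := by
        rw [pow_succ, pow_mul, div_pow]
        field_simp
    _ ≤ 1 := hn.le

/-- If `z ^ n` is bounded in `𝓑^μ` uniformly in large `n`, a gliding hump gives exponents such that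
on each circle at most one of the monomials is not small. -/
theorem exists_strictMono_monomialSize_le (hμ : IsRadialWeight μ) {M : ℝ}
    (hM : ∀ᶠ n : ℕ in atTop, ∀ r ∈ Set.Ico (0 : ℝ) 1, monomialSize μ n r ≤ M) :
    ∃ φ : ℕ → ℕ, StrictMono φ ∧ (∀ k, ∀ r ∈ Set.Ico (0 : ℝ) 1, monomialSize μ (φ k) r ≤ M) ∧
      ∀ i j, i < j → ∀ r ∈ Set.Ico (0 : ℝ) 1,
        monomialSize μ (φ i) r ≤ 1 / ((φ i : ℝ) + 1) ^ 2 ∨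
          monomialSize μ (φ j) r ≤ 1 / ((φ j : ℝ) + 1) ^ 2 := by
  have key : ∀ m : ℕ, ∀ᶠ n : ℕ in atTop, ∀ r ∈ Set.Ico (0 : ℝ) 1,
      monomialSize μ m r ≤ 1 / ((m : ℝ) + 1) ^ 2 ∨
        monomialSize μ n r ≤ 1 / ((n : ℝ) + 1) ^ 2 := by
    intro m
    -- The radius `ρ` separates the humps: beyond it `z ^ m` is small, and up to it `z ^ n` is small
    -- once `n` is large.
    obtain ⟨ρ, hρ, h⟩ := hμ.exists_monomialSize_le m
      (ε := 1 / ((m : ℝ) + 1) ^ 2) (by positivity)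
    filter_upwards [hμ.eventually_monomialSize_le hρ] with n hn r hr
    rcases le_total ρ r with hle | hle
    · exact Or.inl (h r ⟨hle, hr.2⟩)
    · exact Or.inr (hn r ⟨hr.1, hle⟩)
  -- Each new exponent has to suit only the finitely many earlier ones.
  obtain ⟨φ, h1, h2⟩ := exists_seq_of_forall_finset_exists
    (fun n : ℕ => ∀ r ∈ Set.Ico (0 : ℝ) 1, monomialSize μ n r ≤ M)
    (fun m n => m < n ∧ ∀ r ∈ Set.Ico (0 : ℝ) 1,
      monomialSize μ m r ≤ 1 / ((m : ℝ) + 1) ^ 2 ∨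
        monomialSize μ n r ≤ 1 / ((n : ℝ) + 1) ^ 2) (fun s _ =>
      (hM.and ((eventually_all_finset s).2 fun m _ =>
        (eventually_gt_atTop m).and (key m))).exists)
  exact ⟨φ, fun i j hij => (h2 i j hij).1, h1, fun i j hij => (h2 i j hij).2⟩

theorem norm_fracDeriv_term (hμ : IsRadialWeight μ) {b : ℝ} (hb : 0 ≤ b) (n : ℕ) (z : ℂ) :
    ‖(b : ℂ) / (weightMoment μ (2 * n + 1) : ℂ) * z ^ n‖ =
      b * (‖z‖ ^ n / weightMoment μ (2 * n + 1)) := by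
  rw [norm_mul, norm_div, norm_pow, Complex.norm_of_nonneg hb,
    Complex.norm_of_nonneg (hμ.weightMoment_pos _).le]
  ring

end IsRadialWeight

/-! ### Bounded monomials: a member of `𝓑^μ` outside `H^∞` -/

/-- If on each circle at most one of the terms of a sum exceeds a summable bound, the sum is
bounded. -/
theorem sum_le_of_pairwise_le {g δ : ℕ → ℝ} {M : ℝ} (hM : ∀ k, g k ≤ M) (hM0 : 0 ≤ M)
    (hδ0 : ∀ k, 0 ≤ δ k) (hδ : Summable δ) (h : ∀ i j, i < j → g i ≤ δ i ∨ g j ≤ δ j)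
    (s : Finset ℕ) : ∑ k ∈ s, g k ≤ M + ∑' k, δ k := by
  classical
  have hcard : (s.filter fun k => δ k < g k).card ≤ 1 := by
    refine Finset.card_le_one.2 fun i hi j hj => ?_
    have hi' := (Finset.mem_filter.1 hi).2
    have hj' := (Finset.mem_filter.1 hj).2
    rcases lt_trichotomy i j with hij | hij | hij
    · rcases h i j hij with h' | h' <;> linarith
    · exact hij
    · rcases h j i hij with h' | h' <;> linarith
  calc ∑ k ∈ s, g k ≤ ∑ k ∈ s, ((if δ k < g k then M else 0) + δ k) := by
        refine Finset.sum_le_sum fun k _ => ?_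
        split_ifs with hk
        · linarith [hM k, hδ0 k]
        · linarith
    _ = (s.filter fun k => δ k < g k).card * M + ∑ k ∈ s, δ k := by
        rw [Finset.sum_add_distrib, ← Finset.sum_filter, Finset.sum_const, nsmul_eq_mul]
    _ ≤ M + ∑' k, δ k := by
        refine add_le_add (mul_le_of_le_one_left hM0 (mod_cast hcard)) ?_
        exact hδ.sum_le_tsum s fun k _ => hδ0 k

/-- The function `∑ z ^ φ k` is unbounded in the disc. -/
theorem gapSeries_one_notMem_hardyInfty {φ : ℕ → ℕ} (hφ : StrictMono φ) :
    gapSeries φ (fun _ => 1) ∉ hardyInfty := by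
  rintro ⟨-, C, hC⟩
  obtain ⟨N, hN⟩ := exists_nat_gt C
  have hle : ∀ r ∈ Set.Ico (0 : ℝ) 1, ∑ k ∈ Finset.range N, r ^ φ k ≤ C := by
    intro r hr
    have hmem : (r : ℂ) ∈ Metric.ball (0 : ℂ) 1 := by
      rw [mem_ball_zero_iff, Complex.norm_of_nonneg hr.1]
      exact hr.2
    have h := hC (Set.mem_image_of_mem _ hmem)
    have heq : gapSeries φ (fun _ => 1) (r : ℂ) = ((∑' k, r ^ φ k : ℝ) : ℂ) := by
      simp [gapSeries, Complex.ofReal_tsum]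
    simp only [heq] at h
    rw [Complex.norm_of_nonneg (tsum_nonneg fun k => pow_nonneg hr.1 _)] at h
    have hsum : Summable fun k => r ^ φ k :=
      (summable_geometric_of_lt_one hr.1 hr.2).comp_injective hφ.injective
    exact (hsum.sum_le_tsum _ fun k _ => pow_nonneg hr.1 _).trans h
  -- A partial sum of `N > C` terms tends to `N` at the boundary, against the bound `C`.
  have hlim : Tendsto (fun r : ℝ => ∑ k ∈ Finset.range N, r ^ φ k) (𝓝[<] 1) (𝓝 N) := by
    have hcont : Continuous fun r : ℝ => ∑ k ∈ Finset.range N, r ^ φ k := by fun_prop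
    have h := hcont.tendsto 1
    simp only [one_pow, Finset.sum_const, Finset.card_range, nsmul_eq_mul, mul_one] at h
    exact h.mono_left nhdsWithin_le_nhds
  have hNC : (N : ℝ) ≤ C := by
    refine le_of_tendsto hlim ?_
    filter_upwards [Ico_mem_nhdsLT (zero_lt_one (α := ℝ))] with r hr using hle r hr
  linarith

theorem IsRadialWeight.gapSeries_one_mem_blochMu {μ : ℝ → ℝ} (hμ : IsRadialWeight μ)
    {φ : ℕ → ℕ} (hφ : StrictMono φ) {M : ℝ}
    (hM : ∀ k, ∀ r ∈ Set.Ico (0 : ℝ) 1, monomialSize μ (φ k) r ≤ M)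
    (h : ∀ i j, i < j → ∀ r ∈ Set.Ico (0 : ℝ) 1,
      monomialSize μ (φ i) r ≤ 1 / ((φ i : ℝ) + 1) ^ 2 ∨
        monomialSize μ (φ j) r ≤ 1 / ((φ j : ℝ) + 1) ^ 2) :
    gapSeries φ (fun _ => 1) ∈ blochMu μ := by
  have hb : ∀ _ : ℕ, |(1 : ℝ)| ≤ 1 := fun _ => by simp
  refine ⟨analyticOnNhd_gapSeries hφ.injective hb, M + ∑' k, 1 / ((φ k : ℝ) + 1) ^ 2, ?_⟩
  rintro _ ⟨z, hz, rfl⟩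
  have hr : ‖z‖ ∈ Set.Ico (0 : ℝ) 1 := ⟨norm_nonneg z, by simpa using hz⟩
  have hδ : Summable fun k => 1 / ((φ k : ℝ) + 1) ^ 2 := by
    have h1 : Summable fun n : ℕ => 1 / ((n : ℝ) + 1) ^ 2 := by
      simpa using (summable_nat_add_iff 1).2 (Real.summable_one_div_nat_pow.2 one_lt_two)
    exact h1.comp_injective hφ.injective
  have hsum := summable_norm_fracDeriv_gapSeries hμ hφ.injective hb hz
  simp only [fracDeriv_gapSeries μ hφ.injective hb]
  calc weightTail μ z * ‖∑' k, ((1 : ℝ) : ℂ) / (weightMoment μ (2 * φ k + 1) : ℂ) * z ^ φ k‖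
      ≤ weightTail μ z *
          ∑' k, ‖((1 : ℝ) : ℂ) / (weightMoment μ (2 * φ k + 1) : ℂ) * z ^ φ k‖ :=
        mul_le_mul_of_nonneg_left (norm_tsum_le_tsum_norm hsum) (hμ.tail_pos _ hr).le
    _ = ∑' k, monomialSize μ (φ k) ‖z‖ := by
        rw [← tsum_mul_left]
        refine tsum_congr fun k => ?_
        rw [hμ.norm_fracDeriv_term zero_le_one, one_mul]
        rfl
    _ ≤ M + ∑' k, 1 / ((φ k : ℝ) + 1) ^ 2 :=
        Real.tsum_le_of_sum_le (fun k => hμ.monomialSize_nonneg _ hr)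
          (sum_le_of_pairwise_le (fun k => hM k _ hr)
            ((hμ.monomialSize_nonneg _ hr).trans (hM 0 _ hr)) (fun k => by positivity) hδ
            fun i j hij => h i j hij _ hr)

/-! ### Unbounded monomials: a member of `H^∞` outside `𝓑^μ` -/

theorem gapSeries_half_pow_mem_hardyInfty {φ : ℕ → ℕ} (hφ : Function.Injective φ) :
    gapSeries φ (fun k => (1 / 2) ^ k) ∈ hardyInfty := by
  refine ⟨analyticOnNhd_gapSeries hφ fun k => ?_, 2, ?_⟩
  · rw [abs_of_nonneg (by positivity)]
    exact pow_le_one₀ (by norm_num) (by norm_num)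
  · rintro _ ⟨z, hz, rfl⟩
    refine tsum_of_norm_bounded hasSum_geometric_two fun k => ?_
    have hz1 : ‖z‖ ≤ 1 := (mem_ball_zero_iff.1 hz).le
    rw [norm_mul, norm_pow, Complex.norm_of_nonneg (by positivity)]
    exact mul_le_of_le_one_right (by positivity) (pow_le_one₀ (norm_nonneg z) hz1)

/-- At a positive radius the fractional derivative is a sum of nonnegative terms and dominates its
`k`-th term alone, which after weighting exceeds `2⁻ᵏ * 4 ^ k = 2 ^ k`. -/
theorem IsRadialWeight.gapSeries_half_pow_notMem_blochMu {μ : ℝ → ℝ} (hμ : IsRadialWeight μ)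
    {φ : ℕ → ℕ} (hφ : Function.Injective φ)
    (h : ∀ k, ∃ r ∈ Set.Ico (0 : ℝ) 1, 4 ^ k < monomialSize μ (φ k) r) :
    gapSeries φ (fun k => (1 / 2) ^ k) ∉ blochMu μ := by
  have hb0 : ∀ k : ℕ, (0 : ℝ) ≤ (1 / 2) ^ k := fun k => by positivity
  have hb : ∀ k : ℕ, |(1 / 2 : ℝ) ^ k| ≤ 1 := fun k => by
    rw [abs_of_nonneg (hb0 k)]
    exact pow_le_one₀ (by norm_num) (by norm_num)
  rintro ⟨-, C, hC⟩
  obtain ⟨k, hk⟩ := pow_unbounded_of_one_lt C (one_lt_two (α := ℝ))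
  obtain ⟨r, hr, hrk⟩ := h k
  have hnorm : ‖(r : ℂ)‖ = r := Complex.norm_of_nonneg hr.1
  have hmem : (r : ℂ) ∈ Metric.ball (0 : ℂ) 1 := by
    rw [mem_ball_zero_iff, hnorm]
    exact hr.2
  have hsum := summable_norm_fracDeriv_gapSeries hμ hφ hb hmem
  simp only [hμ.norm_fracDeriv_term (hb0 _), hnorm] at hsum
  have hterm : ∀ j, 0 ≤ (1 / 2) ^ j * (r ^ φ j / weightMoment μ (2 * φ j + 1)) := fun j =>
    mul_nonneg (hb0 j) (div_nonneg (pow_nonneg hr.1 _) (hμ.weightMoment_pos _).le)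
  have heq : fracDeriv μ (gapSeries φ fun k => (1 / 2) ^ k) (r : ℂ) =
      ((∑' j, (1 / 2) ^ j * (r ^ φ j / weightMoment μ (2 * φ j + 1)) : ℝ) : ℂ) := by
    rw [fracDeriv_gapSeries μ hφ hb, Complex.ofReal_tsum]
    refine tsum_congr fun j => ?_
    push_cast
    ring
  have hle := hC (Set.mem_image_of_mem _ hmem)
  simp only [heq, weightTail, hnorm] at hle
  rw [Complex.norm_of_nonneg (tsum_nonneg hterm)] at hle
  have hpow : (2 : ℝ) ^ k = (1 / 2) ^ k * 4 ^ k := by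
    rw [← mul_pow]
    norm_num
  have : (1 / 2 : ℝ) ^ k * monomialSize μ (φ k) r ≤ C :=
    calc (1 / 2 : ℝ) ^ k * monomialSize μ (φ k) r = (∫ s in Set.Ico r 1, μ s) *
          ((1 / 2) ^ k * (r ^ φ k / weightMoment μ (2 * φ k + 1))) := by
          rw [monomialSize]
          ring
      _ ≤ _ := mul_le_mul_of_nonneg_left (hsum.le_tsum k fun j _ => hterm j)
          (hμ.tail_pos r hr).le
      _ ≤ C := hle
  have := mul_le_mul_of_nonneg_left hrk.le (hb0 k)
  linarith

theorem proposition1 (μ : ℝ → ℝ) (hμ : IsRadialWeight μ) : hardyInfty ≠ blochMu μ := by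
  intro heq
  by_cases hM : ∃ M : ℝ, ∀ᶠ n : ℕ in atTop, ∀ r ∈ Set.Ico (0 : ℝ) 1, monomialSize μ n r ≤ M
  · obtain ⟨M, hM⟩ := hM
    obtain ⟨φ, hφ, hb, hpair⟩ := hμ.exists_strictMono_monomialSize_le hM
    exact gapSeries_one_notMem_hardyInfty hφ
      (heq ▸ hμ.gapSeries_one_mem_blochMu hφ hb hpair)
  · push Not at hM
    obtain ⟨φ, hφ, h⟩ := extraction_forall_of_frequently fun k => hM (4 ^ k)
    exact hμ.gapSeries_half_pow_notMem_blochMu hφ.injective h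
      (heq ▸ gapSeries_half_pow_mem_hardyInfty hφ.injective)
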